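/- For integers $1\le k\le d$ let $\mathcal P_{k,d,2}$ be the class of distributions $P_{\theta,\zeta}$ of $(x,y)\in\mathbb R^d\times\mathbb R$ with $x$ uniform on $\{\pm1\}^d$ and $y=\langle\theta,x\rangle+\zeta$, where $\theta\in\mathbb R^d$ satisfies $\|\theta\|_1\le 1$ and $\|\theta\|_0\le k$, and the noise $\zeta$ (which may depend on $x$) satisfies $\mathbb E[\zeta\mid x]=0$ and $|\zeta|\le 2$ almost surely. A non-interactive algorithm $\mathcal A$ for $n$ users consists of Markov kernels $Q_1,\dots,Q_n$ from $\mathbb R^d\times\mathbb R$ to arbitrary measurable message spaces and a (possibly randomized) estimator: given $D=\{(x_i,y_i)\}_{i=1}^n$, user $i$ draws a message $Z_i\sim Q_i(\cdot\mid x_i,y_i)$, independently over $i$, and $\mathcal A(D)\in\mathbb R^d$ is computed by the estimator from $(Z_1,\dots,Z_n)$. It is $\epsilon$-non-interactively locally differentially private ($\epsilon$-NLDP) if $Q_i(S\mid v)\le e^{\epsilon}Q_i(S\mid v')$ for all $i$, all events $S$, and all $v,v'$ in the data universe $\{\pm1\}^d\times[-3,3]$. There is a universal constant $c>0$ such that for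 all $n\ge 0$, $1\le k\le d$, $0<\epsilon\le 1$ and every $\epsilon$-NLDP algorithm $\mathcal A$ for $n$ users the following hold. (1) If $0<\nu\le 1/\sqrt k$ and $$\mathbb E_{\mathcal A,\,D\sim P_{\theta,\zeta}^{\otimes n}}\big[\|\mathcal A(D)-\theta\|_2\big]\le\frac{\nu}{8}\qquad\text{for every }P_{\theta,\zeta}\in\mathcal P_{k,d,2},$$ then $$n\ \ge\ c\,\frac{dk\log(d/k)}{\nu^2\epsilon^2}.$$ (2) If $n\ge 1$, there is an instance $P_{\theta,\zeta}\in\mathcal P_{k,d,2}$ with $$\mathbb E_{\mathcal A,\,D\sim P_{\theta,\zeta}^{\otimes n}}\big[\|\mathcal A(D)-\theta\|_2\big]\ \ge\ c\,\min\Big\{\frac1{\sqrt k},\ \sqrt{\frac{dk\log(d/k)}{n\epsilon^2}}\Big\}.$$ -/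

import Mathlib

open MeasureTheory ProbabilityTheory
open scoped ENNReal

universe u

noncomputable section

namespace SparseLDP

/-- The sign cube `{-1, +1}^d` inside Euclidean space. -/
def signCube (d : ℕ) : Set (EuclideanSpace ℝ (Fin d)) :=
  {x | ∀ i, x i = 1 ∨ x i = -1}

/-- A data record `(x, y)` of one user: a covariate vector and a response. -/
abbrev Record (d : ℕ) : Type := EuclideanSpace ℝ (Fin d) × ℝ

/-- The data universe of the class below: covariates in `{-1, +1}^d` and responses in
`[-(1 + C), 1 + C]` (note `|⟨θ, x⟩ + ζ| ≤ ‖θ‖₁ + C ≤ 1 + C`). -/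
def dataUniverse (d : ℕ) (C : ℝ) : Set (Record d) :=
  {v | v.1 ∈ signCube d ∧ |v.2| ≤ 1 + C}

/-- `μ` is the joint law of `(x, ζ)` with `x` uniform on `{-1, +1}^d`, and `ζ` a noise variable with
`|ζ| ≤ C` almost surely and `𝔼[ζ | x] = 0` (the noise may depend on `x`). -/
structure IsDesignNoiseLaw (d : ℕ) (C : ℝ) (μ : Measure (EuclideanSpace ℝ (Fin d) × ℝ)) :
    Prop where
  isProb : IsProbabilityMeasure μ
  design_uniform : μ.map Prod.fst = uniformOn (signCube d)
  noise_bounded : ∀ᵐ w ∂μ, |w.2| ≤ C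
  noise_centered :
    μ[Prod.snd | MeasurableSpace.comap Prod.fst
      (inferInstance : MeasurableSpace (EuclideanSpace ℝ (Fin d)))] =ᵐ[μ] 0

/-- `P` belongs to the class `𝒫_{k,d,C}` with regression vector `θ`: `‖θ‖₁ ≤ 1`, `‖θ‖₀ ≤ k`, and
`P` is the law of `(x, y)` with `y = ⟨θ, x⟩ + ζ`. -/
structure InClass (k d : ℕ) (C : ℝ) (θ : EuclideanSpace ℝ (Fin d)) (P : Measure (Record d)) :
    Prop where
  l1_le : ∑ i, |θ i| ≤ 1
  l0_le : {i | θ i ≠ 0}.ncard ≤ k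
  law : ∃ μ : Measure (EuclideanSpace ℝ (Fin d) × ℝ), IsDesignNoiseLaw d C μ ∧
    P = μ.map (fun w => (w.1, inner ℝ θ w.1 + w.2))

/-- A non-interactive local algorithm for `n` users: user `i` sends a single message drawn from
`channel i (x_i, y_i)`, independently of all the other users and of their data, and the server
outputs a possibly randomized function of the `n` messages. Message spaces are arbitrary. -/
structure NonInteractiveAlgorithm (n d : ℕ) where
  Msg : Fin n → Type u
  [measurableMsg : ∀ i, MeasurableSpace (Msg i)]
  channel : ∀ i, Kernel (Record d) (Msg i)
  [markovChannel : ∀ i, IsMarkovKernel (channel i)]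
  estimator : Kernel (∀ i, Msg i) (EuclideanSpace ℝ (Fin d))
  [markovEstimator : IsMarkovKernel estimator]

attribute [instance] NonInteractiveAlgorithm.measurableMsg
  NonInteractiveAlgorithm.markovChannel NonInteractiveAlgorithm.markovEstimator

namespace NonInteractiveAlgorithm

variable {n d : ℕ}

/-- `ε`-non-interactive local differential privacy on the data universe `𝒟`: for every user `i`,
all `v, v' ∈ 𝒟` and all events `S`, `Q_i(S | v) ≤ e^ε Q_i(S | v')`. -/
def IsLDP (A : NonInteractiveAlgorithm.{u} n d) (𝒟 : Set (Record d)) (ε : ℝ) : Prop :=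
  ∀ i, ∀ v ∈ 𝒟, ∀ v' ∈ 𝒟, ∀ S : Set (A.Msg i), MeasurableSet S →
    A.channel i v S ≤ ENNReal.ofReal (Real.exp ε) * A.channel i v' S

/-- The law of the output `A(D)` on a fixed data set `D`. -/
def outputLaw (A : NonInteractiveAlgorithm.{u} n d) (D : Fin n → Record d) :
    Measure (EuclideanSpace ℝ (Fin d)) :=
  (Measure.pi fun i => A.channel i (D i)).bind A.estimator

/-- The expected `ℓ₂` error `𝔼_{A, D ∼ P^{⊗n}} ‖A(D) - θ‖₂`, with value in `[0, ∞]`. -/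
def expectedError (A : NonInteractiveAlgorithm.{u} n d) (P : Measure (Record d))
    (θ : EuclideanSpace ℝ (Fin d)) : ℝ≥0∞ :=
  ∫⁻ D, ∫⁻ t, ENNReal.ofReal ‖t - θ‖ ∂(A.outputLaw D) ∂(Measure.pi fun _ : Fin n => P)

end NonInteractiveAlgorithm

end SparseLDP

end

-- The lower bound is a Fano argument over a product family. The coordinates hold `q` disjoint
-- blocks of size `m`, and `sparseVec` puts one entry `±τ` in each block, so `v` ranges over `q`
-- independent symbols from an alphabet of size `2m`. The response is a sign with conditional mean
-- `⟨θ, x⟩`.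
--
-- Privacy bounds the information carried by one message. The message densities of single records,
-- taken relative to the message law at `θ = 0`, lie in `[e^{-ε}, e^ε]`. The law of a record is
-- affine in `θ`, so the mixed density differs from `1` by `⟨θ, a⟩`, where `a` depends on the
-- message. Bessel's inequality on the sign cube gives `‖a‖ ≤ 2ε`
-- (`norm_sq_average_smul_signPoint_le`), and averaging over the family gains a factor `1/m`
-- (`sum_inner_sparseVec_sq_le`). The mean `χ²`-divergence per user is therefore at most `4τ²ε²/m`
-- (`exists_channel_densities`).
--
-- Small error forces the output to be close to `sparseVec ι τ v` in most blocks. Under blind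
-- guessing the count of such blocks has a small exponential moment (`sum_exp_accepted_le`), so
-- entropy duality (`sum_integral_prod_mul_le`) yields `q log(2m) ≲ nτ²ε²/m`. Taking `q` of order
-- `k` (at most `d/2`), `m` of order `d/q` and `τ = ν/√q` gives the first claim. The second follows
-- by contradiction, with `ν` a small multiple of the claimed error.

noncomputable section

namespace SparseLDP

-- Moments of uniform assignments.

section Combinatorics

variable {J S : Type*} [Fintype J] [DecidableEq J] [Fintype S]

lemma sum_pi_prod (f : J → S → ℝ) : ∑ v : J → S, ∏ j, f j (v j) = ∏ j, ∑ s, f j s := by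
  rw [Finset.prod_univ_sum, Fintype.piFinset_univ]

/-- Cross-multiplied by the alphabet size, to avoid division and the truncated exponent `|J| - 1`.
-/
lemma card_mul_sum_pi_eval (j : J) (g : S → ℝ) :
    (Fintype.card S : ℝ) * ∑ v : J → S, g (v j) =
      (Fintype.card S : ℝ) ^ Fintype.card J * ∑ s, g s := by
  have h1 : ∀ v : J → S, g (v j) = ∏ l, (if l = j then g (v l) else 1) := by
    intro v; simp
  simp_rw [h1]
  rw [sum_pi_prod (fun l s => if l = j then g s else 1),
    ← Finset.mul_prod_erase _ _ (Finset.mem_univ j)]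
  have h2 : ∏ l ∈ Finset.univ.erase j, ∑ s, (if l = j then g s else 1) =
      (Fintype.card S : ℝ) ^ (Fintype.card J - 1) := by
    rw [Finset.prod_congr rfl (g := fun _ => (Fintype.card S : ℝ))]
    · simp [Finset.card_erase_of_mem]
    · intro l hl
      simp [Finset.ne_of_mem_erase hl]
  rw [h2]
  have hJ : Fintype.card J = (Fintype.card J - 1) + 1 := by
    have := Fintype.card_pos_iff.mpr ⟨j⟩
    omega
  conv_rhs => rw [hJ, pow_succ]
  simp only [if_true]
  ring

/-- The sum of the squares of a sum of independent centered terms, over all assignments. -/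
lemma card_mul_sum_pi_sq (X : J → S → ℝ) (hX : ∀ j, ∑ s, X j s = 0) :
    (Fintype.card S : ℝ) * ∑ v : J → S, (∑ j, X j (v j)) ^ 2 =
      (Fintype.card S : ℝ) ^ Fintype.card J * ∑ j, ∑ s, X j s ^ 2 := by
  have hcross : ∀ j l, l ≠ j → ∑ v : J → S, X j (v j) * X l (v l) = 0 := by
    intro j l hlj
    have h1 : ∀ v : J → S, X j (v j) * X l (v l) =
        ∏ i, (if i = j then X j (v i) else 1) * (if i = l then X l (v i) else 1) := by
      intro v; rw [Finset.prod_mul_distrib]; simp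
    simp_rw [h1]
    rw [sum_pi_prod (fun i s => (if i = j then X j s else 1) * (if i = l then X l s else 1))]
    apply Finset.prod_eq_zero (Finset.mem_univ j)
    simp [hlj.symm, hX]
  have h2 : ∑ v : J → S, (∑ j, X j (v j)) ^ 2 = ∑ j, ∑ v : J → S, X j (v j) ^ 2 := by
    simp_rw [sq, Finset.sum_mul_sum]
    rw [Finset.sum_comm]
    refine Finset.sum_congr rfl fun j _ => ?_
    rw [Finset.sum_comm, Finset.sum_eq_single j]
    · intro l _ hl; exact hcross j l hl
    · simp
  rw [h2, Finset.mul_sum, Finset.mul_sum]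
  exact Finset.sum_congr rfl fun j _ => card_mul_sum_pi_eval j fun s => X j s ^ 2

open Classical in
/-- If in every coordinate at most one symbol is accepted, the exponential moment of the number of
accepted coordinates of a uniform assignment is at most `2 ^ |J|`. -/
lemma sum_exp_accepted_le [Nonempty S] (A : J → S → Prop)
    (hA : ∀ j s s', A j s → A j s' → s = s') :
    ∑ v : J → S, Real.exp (Real.log (Fintype.card S) * ∑ j, if A j (v j) then (1 : ℝ) else 0) ≤
      (Fintype.card S : ℝ) ^ Fintype.card J * 2 ^ Fintype.card J := by
  have hpos : (0 : ℝ) < Fintype.card S := by exact_mod_cast Fintype.card_pos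
  simp_rw [Finset.mul_sum, Real.exp_sum]
  rw [sum_pi_prod (fun j s => Real.exp (Real.log (Fintype.card S) * if A j s then (1 : ℝ) else 0)),
    ← mul_pow, ← Finset.card_univ (α := J), ← Finset.prod_const]
  refine Finset.prod_le_prod (fun j _ => by positivity) fun j _ => ?_
  -- An accepted symbol weighs `|S|`, any other weighs `1`. With at most one accepted, each
  -- coordinate sums to at most `2|S|`.
  have h1 : ∀ s, Real.exp (Real.log (Fintype.card S) * if A j s then (1 : ℝ) else 0) ≤
      1 + if A j s then (Fintype.card S : ℝ) else 0 := by
    intro s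
    split_ifs
    · rw [mul_one, Real.exp_log hpos]; linarith
    · simp
  refine (Finset.sum_le_sum fun s _ => h1 s).trans ?_
  rw [Finset.sum_add_distrib]
  have h2 : ∑ s, (if A j s then (Fintype.card S : ℝ) else 0) ≤ Fintype.card S := by
    by_cases h : ∃ s, A j s
    · obtain ⟨s, hs⟩ := h
      rw [Finset.sum_eq_single s]
      · simp [hs]
      · intro s' _ hne
        simp [show ¬ A j s' from fun h' => hne (hA j _ _ h' hs)]
      · simp
    · push Not at h
      simp [h]
  simp
  linarith

end Combinatorics

/-- The sign encoded by a Boolean. -/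
def sgn (b : Bool) : ℝ := if b then 1 else -1

@[simp] lemma sgn_true : sgn true = 1 := rfl
@[simp] lemma sgn_false : sgn false = -1 := by simp [sgn]
@[simp] lemma sgn_sq (b : Bool) : sgn b ^ 2 = 1 := by cases b <;> simp
@[simp] lemma abs_sgn (b : Bool) : |sgn b| = 1 := by cases b <;> simp

-- The hard family of block-sparse vectors.

section SparseVectors

variable {q m d : ℕ}

/-- One nonzero entry `±τ` in each block of coordinates. -/
def sparseVec (ι : Fin q × Fin m ↪ Fin d) (τ : ℝ) (v : Fin q → Fin m × Bool) :
    EuclideanSpace ℝ (Fin d) :=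
  WithLp.toLp 2 fun i => ∑ j, if i = ι (j, (v j).1) then τ * sgn (v j).2 else 0

variable (ι : Fin q × Fin m ↪ Fin d) (τ : ℝ)

lemma sparseVec_apply (v : Fin q → Fin m × Bool) (i : Fin d) :
    sparseVec ι τ v i = ∑ j, if i = ι (j, (v j).1) then τ * sgn (v j).2 else 0 := rfl

lemma inner_sparseVec (v : Fin q → Fin m × Bool) (a : EuclideanSpace ℝ (Fin d)) :
    inner ℝ (sparseVec ι τ v) a = ∑ j, τ * sgn (v j).2 * a (ι (j, (v j).1)) := by
  simp only [sparseVec, PiLp.inner_apply, RCLike.inner_apply, conj_trivial, Finset.mul_sum]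
  rw [Finset.sum_comm]
  refine Finset.sum_congr rfl fun j _ => ?_
  simp [mul_comm]

lemma sum_abs_sparseVec_le (hτ : 0 ≤ τ) (v : Fin q → Fin m × Bool) :
    ∑ i, |sparseVec ι τ v i| ≤ q * τ := by
  calc ∑ i, |sparseVec ι τ v i|
      ≤ ∑ i, ∑ j, (if i = ι (j, (v j).1) then τ else 0) := by
        refine Finset.sum_le_sum fun i _ => ?_
        rw [sparseVec_apply]
        refine (Finset.abs_sum_le_sum_abs _ _).trans (Finset.sum_le_sum fun j _ => ?_)
        split_ifs
        · rw [abs_mul, abs_sgn, abs_of_nonneg hτ, mul_one]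
        · simp
    _ = q * τ := by rw [Finset.sum_comm]; simp

lemma ncard_support_sparseVec_le (v : Fin q → Fin m × Bool) :
    {i | sparseVec ι τ v i ≠ 0}.ncard ≤ q := by
  have hsub : {i | sparseVec ι τ v i ≠ 0} ⊆ Set.range fun j => ι (j, (v j).1) := by
    intro i hi
    by_contra hne
    apply hi
    rw [sparseVec_apply]
    refine Finset.sum_eq_zero fun j _ => if_neg ?_
    rintro rfl
    exact hne ⟨j, rfl⟩
  refine (Set.ncard_le_ncard hsub (Set.finite_range _)).trans ?_
  rw [← Set.image_univ]
  refine (Set.ncard_image_le Set.finite_univ).trans ?_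
  simp [Set.ncard_univ]

/-- A block of `sparseVec`. -/
def blockVec (s : Fin m × Bool) (p : Fin m) : ℝ := if p = s.1 then τ * sgn s.2 else 0

lemma sparseVec_apply_block (v : Fin q → Fin m × Bool) (j : Fin q) (p : Fin m) :
    sparseVec ι τ v (ι (j, p)) = blockVec τ (v j) p := by
  simp only [sparseVec, blockVec]
  rw [Finset.sum_eq_single j]
  · simp
  · intro l _ hl
    rw [if_neg]
    simp [hl.symm]
  · simp

/-- Opposite signs at one position give `4τ²`; distinct positions give `2τ²`. -/
lemma two_mul_sq_le_blockVec_dist {s s' : Fin m × Bool} (h : s ≠ s') :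
    2 * τ ^ 2 ≤ ∑ p, (blockVec τ s p - blockVec τ s' p) ^ 2 := by
  obtain ⟨p, b⟩ := s
  obtain ⟨p', b'⟩ := s'
  by_cases hp : p = p'
  · subst hp
    have hb : b ≠ b' := fun hb => h (by rw [hb])
    refine le_trans ?_ (Finset.single_le_sum
      (f := fun i => (blockVec τ (p, b) i - blockVec τ (p, b') i) ^ 2)
      (fun i _ => sq_nonneg _) (Finset.mem_univ p))
    have : (sgn b - sgn b') ^ 2 = 4 := by
      cases b <;> cases b' <;> simp_all <;> norm_num
    simp only [blockVec, if_true, ← mul_sub, mul_pow, this]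
    nlinarith [sq_nonneg τ]
  · refine le_trans ?_ (Finset.sum_le_sum_of_subset_of_nonneg (Finset.subset_univ {p, p'})
      fun i _ _ => sq_nonneg _)
    rw [Finset.sum_pair hp]
    simp [blockVec, hp, Ne.symm hp, mul_pow]
    linarith

/-- The `j`-th block of `t` is close to the block encoded by the symbol `s`. -/
def Near (t : EuclideanSpace ℝ (Fin d)) (j : Fin q) (s : Fin m × Bool) : Prop :=
  ∑ p, (t (ι (j, p)) - blockVec τ s p) ^ 2 < τ ^ 2 / 2

/-- The threshold `τ²/2` is fitted to the separation `2τ²`: by `(a - b)² ≤ 2a² + 2b²`, two near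
symbols would be at squared distance below `2τ²`. -/
lemma near_unique (t : EuclideanSpace ℝ (Fin d)) (j : Fin q) (s s' : Fin m × Bool)
    (h : Near ι τ t j s) (h' : Near ι τ t j s') : s = s' := by
  by_contra hne
  have h1 := two_mul_sq_le_blockVec_dist τ hne
  have h2 : ∑ p, (blockVec τ s p - blockVec τ s' p) ^ 2 ≤
      ∑ p, (2 * (t (ι (j, p)) - blockVec τ s p) ^ 2 +
        2 * (t (ι (j, p)) - blockVec τ s' p) ^ 2) := by
    refine Finset.sum_le_sum fun p _ => ?_
    nlinarith [sq_nonneg (t (ι (j, p)) - blockVec τ s p + (t (ι (j, p)) - blockVec τ s' p))]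
  rw [Finset.sum_add_distrib, ← Finset.mul_sum, ← Finset.mul_sum] at h2
  unfold Near at h h'
  linarith

open Classical in
/-- The number of blocks in which `t` is close to `sparseVec ι τ v`. -/
def numNear (v : Fin q → Fin m × Bool) (t : EuclideanSpace ℝ (Fin d)) : ℝ :=
  ∑ j, if Near ι τ t j (v j) then (1 : ℝ) else 0

lemma numNear_nonneg (v : Fin q → Fin m × Bool) (t : EuclideanSpace ℝ (Fin d)) :
    0 ≤ numNear ι τ v t :=
  Finset.sum_nonneg fun j _ => by split_ifs <;> norm_num

lemma numNear_le (v : Fin q → Fin m × Bool) (t : EuclideanSpace ℝ (Fin d)) :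
    numNear ι τ v t ≤ q := by
  classical
  calc numNear ι τ v t ≤ ∑ _j : Fin q, (1 : ℝ) :=
        Finset.sum_le_sum fun j _ => by split_ifs <;> norm_num
    _ = q := by simp

lemma measurable_numNear (v : Fin q → Fin m × Bool) : Measurable (numNear ι τ v) := by
  classical
  refine Finset.measurable_sum _ fun j _ => Measurable.ite ?_ measurable_const measurable_const
  have : Measurable fun t : EuclideanSpace ℝ (Fin d) =>
      ∑ p, (t (ι (j, p)) - blockVec τ (v j) p) ^ 2 := by fun_prop
  exact measurableSet_lt this measurable_const

/-- Each block that is not near costs `τ²/2` in squared norm. The resulting bound is made linear in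
the count by `(q - N)² ≤ q(q - N)`, so that a bound on the first moment of the error suffices. -/
lemma le_norm_sub_sparseVec (hq : 0 < q) (v : Fin q → Fin m × Bool)
    (t : EuclideanSpace ℝ (Fin d)) :
    τ / √(2 * q) * (q - numNear ι τ v t) ≤ ‖t - sparseVec ι τ v‖ := by
  classical
  have hq' : (0 : ℝ) < q := by exact_mod_cast hq
  have hn := numNear_le ι τ v t
  have hn0 := numNear_nonneg ι τ v t
  have key : τ ^ 2 / 2 * (q - numNear ι τ v t) ≤ ‖t - sparseVec ι τ v‖ ^ 2 := by
    rw [EuclideanSpace.norm_sq_eq]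
    have hsum : ∑ x : Fin q × Fin m, (t (ι x) - sparseVec ι τ v (ι x)) ^ 2 ≤
        ∑ i, ‖(t - sparseVec ι τ v) i‖ ^ 2 := by
      rw [← Finset.sum_map Finset.univ ι fun i => (t i - sparseVec ι τ v i) ^ 2]
      refine (Finset.sum_le_sum_of_subset_of_nonneg (Finset.subset_univ _)
        fun i _ _ => sq_nonneg _).trans_eq ?_
      simp
    refine le_trans ?_ hsum
    rw [Fintype.sum_prod_type]
    have h1 : τ ^ 2 / 2 * (q - numNear ι τ v t) =
        ∑ j : Fin q, τ ^ 2 / 2 * (1 - if Near ι τ t j (v j) then (1 : ℝ) else 0) := by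
      rw [← Finset.mul_sum, Finset.sum_sub_distrib]; simp [numNear]
    rw [h1]
    refine Finset.sum_le_sum fun j _ => ?_
    simp_rw [sparseVec_apply_block]
    split_ifs with h
    · simpa using Finset.sum_nonneg fun p _ => sq_nonneg _
    · simpa [Near] using h
  refine le_of_abs_le (abs_le_of_sq_le_sq ?_ (norm_nonneg _))
  refine le_trans ?_ key
  rw [mul_pow, div_pow, Real.sq_sqrt (by positivity)]
  have h2 : (q - numNear ι τ v t) ^ 2 ≤ q * (q - numNear ι τ v t) := by nlinarith
  calc τ ^ 2 / (2 * q) * (q - numNear ι τ v t) ^ 2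
      ≤ τ ^ 2 / (2 * q) * (q * (q - numNear ι τ v t)) := by gcongr
    _ = _ := by field_simp

/-- The second moment of `⟨θ, a⟩` for a uniformly chosen `sparseVec` `θ`. -/
lemma sum_inner_sparseVec_sq_le (hm : 0 < m) (a : EuclideanSpace ℝ (Fin d)) :
    ∑ v : Fin q → Fin m × Bool, (inner ℝ (sparseVec ι τ v) a) ^ 2 ≤
      Fintype.card (Fin q → Fin m × Bool) * (τ ^ 2 / m * ‖a‖ ^ 2) := by
  have hm' : (0 : ℝ) < m := by exact_mod_cast hm
  -- The uniform sign in each symbol centers the block contributions, so only diagonal terms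
  -- survive.
  have h := card_mul_sum_pi_sq (J := Fin q) (S := Fin m × Bool)
    (fun j s => τ * sgn s.2 * a (ι (j, s.1))) (fun j => by
      rw [Fintype.sum_prod_type]; simp)
  have h2 : ∑ j : Fin q, ∑ s : Fin m × Bool, (τ * sgn s.2 * a (ι (j, s.1))) ^ 2 ≤
      2 * τ ^ 2 * ‖a‖ ^ 2 := by
    have h3 : ∑ j : Fin q, ∑ s : Fin m × Bool, (τ * sgn s.2 * a (ι (j, s.1))) ^ 2 =
        2 * τ ^ 2 * ∑ x : Fin q × Fin m, a (ι x) ^ 2 := by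
      simp only [Fintype.sum_prod_type, mul_pow, sgn_sq, Finset.mul_sum]
      refine Finset.sum_congr rfl fun j _ => Finset.sum_congr rfl fun p _ => ?_
      simp; ring
    rw [h3]
    gcongr
    rw [EuclideanSpace.norm_sq_eq, ← Finset.sum_map Finset.univ ι fun i => a i ^ 2]
    refine (Finset.sum_le_sum_of_subset_of_nonneg (Finset.subset_univ _)
        fun i _ _ => sq_nonneg _).trans_eq ?_
    simp
  simp_rw [inner_sparseVec]
  have hc : (Fintype.card (Fin m × Bool) : ℝ) = 2 * m := by simp; ring
  have hV : (Fintype.card (Fin q → Fin m × Bool) : ℝ) =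
      (Fintype.card (Fin m × Bool) : ℝ) ^ Fintype.card (Fin q) := by simp
  rw [hV]
  set K : ℝ := (Fintype.card (Fin m × Bool) : ℝ) ^ Fintype.card (Fin q)
  have hK : 0 ≤ K := by positivity
  rw [hc] at h
  have h4 := mul_le_mul_of_nonneg_left h2 hK
  rw [← h] at h4
  have h5 : K * (τ ^ 2 / m * ‖a‖ ^ 2) = K * (2 * τ ^ 2 * ‖a‖ ^ 2) / (2 * m) := by
    field_simp
  rw [h5, le_div_iff₀ (by positivity), mul_comm]
  exact h4

end SparseVectors

-- Instances with binary responses.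

section Instance

variable {d : ℕ}

/-- The point of the sign cube encoded by a Boolean vector. -/
def signPoint (b : Fin d → Bool) : EuclideanSpace ℝ (Fin d) := WithLp.toLp 2 fun i => sgn (b i)

@[simp] lemma signPoint_apply (b : Fin d → Bool) (i : Fin d) : signPoint b i = sgn (b i) := rfl

lemma signPoint_injective : Function.Injective (signPoint (d := d)) := by
  intro b b' h
  funext i
  have := congrArg (fun x : EuclideanSpace ℝ (Fin d) => x i) h
  simp only [signPoint_apply] at this
  revert this
  cases b i <;> cases b' i <;> norm_num

lemma range_signPoint : Set.range (signPoint (d := d)) = signCube d := by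
  ext x
  constructor
  · rintro ⟨b, rfl⟩ i
    simp only [signPoint_apply]
    cases b i <;> simp
  · intro hx
    refine ⟨fun i => decide (x i = 1), ?_⟩
    ext i
    rcases hx i with h | h <;> simp [h, sgn]
    norm_num

lemma signPoint_mem (b : Fin d → Bool) : signPoint b ∈ signCube d := range_signPoint ▸ ⟨b, rfl⟩

lemma uniformOn_signCube : uniformOn (signCube d) =
    ∑ b : Fin d → Bool, ENNReal.ofReal (1 / 2 ^ d) • Measure.dirac (signPoint b) := by
  have hfin : (signCube d).Finite := range_signPoint ▸ Set.finite_range _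
  ext s hs
  rw [uniformOn, cond_apply hfin.measurableSet, Measure.finsetSum_apply]
  have h1 : Measure.count (signCube d) = (2 : ℝ≥0∞) ^ d := by
    rw [Measure.count_apply hfin.measurableSet, ← range_signPoint, ← Set.image_univ,
      signPoint_injective.encard_image]
    simp [Set.encard_univ]
  have h2 : Measure.count (signCube d ∩ s) =
      ∑ b : Fin d → Bool, s.indicator (1 : EuclideanSpace ℝ (Fin d) → ℝ≥0∞) (signPoint b) := by
    classical
    rw [Measure.count_apply (hfin.measurableSet.inter hs), ← range_signPoint,
      Set.inter_comm, ← Set.image_preimage_eq_inter_range, signPoint_injective.encard_image,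
      Set.encard_eq_coe_toFinset_card]
    simp only [Set.indicator_apply, Finset.sum_ite, Pi.one_apply]
    simp
  rw [h1, h2, Finset.mul_sum]
  refine Finset.sum_congr rfl fun b _ => ?_
  rw [Measure.smul_apply, Measure.dirac_apply' _ hs, smul_eq_mul]
  congr 1
  rw [one_div, ENNReal.ofReal_inv_of_pos (by positivity), ENNReal.ofReal_pow (by norm_num)]
  simp

/-- The probability of `(x, y) = (signPoint b, sgn y)` in the instance with binary responses. -/
def wt (θ : EuclideanSpace ℝ (Fin d)) (ω : (Fin d → Bool) × Bool) : ℝ :=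
  (1 + sgn ω.2 * inner ℝ θ (signPoint ω.1)) / (2 * 2 ^ d)

lemma sum_wt (θ : EuclideanSpace ℝ (Fin d)) : ∑ ω, wt θ ω = 1 := by
  rw [Fintype.sum_prod_type]
  have : ∀ b : Fin d → Bool, ∑ y, wt θ (b, y) = 1 / 2 ^ d := by
    intro b; simp [wt]; field_simp; ring
  simp_rw [this]
  simp

lemma abs_inner_signPoint_le (θ : EuclideanSpace ℝ (Fin d)) (b : Fin d → Bool) :
    |inner ℝ θ (signPoint b)| ≤ ∑ i, |θ i| := by
  simp only [PiLp.inner_apply, RCLike.inner_apply, conj_trivial, signPoint_apply]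
  refine (Finset.abs_sum_le_sum_abs _ _).trans_eq ?_
  simp [abs_mul]

lemma wt_nonneg {θ : EuclideanSpace ℝ (Fin d)} (hθ : ∑ i, |θ i| ≤ 1)
    (ω : (Fin d → Bool) × Bool) : 0 ≤ wt θ ω := by
  have h := abs_le.mp ((abs_inner_signPoint_le θ ω.1).trans hθ)
  refine div_nonneg ?_ (by positivity)
  obtain ⟨b, y⟩ := ω
  cases y <;> simp at h ⊢ <;> linarith

/-- The law of the covariate and the noise in the instance with binary responses. -/
def designLaw (θ : EuclideanSpace ℝ (Fin d)) : Measure (EuclideanSpace ℝ (Fin d) × ℝ) :=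
  ∑ ω : (Fin d → Bool) × Bool, ENNReal.ofReal (wt θ ω) •
    Measure.dirac (signPoint ω.1, sgn ω.2 - inner ℝ θ (signPoint ω.1))

/-- The record with binary response encoded by Booleans. -/
def recordPoint (ω : (Fin d → Bool) × Bool) : Record d := (signPoint ω.1, sgn ω.2)

lemma recordPoint_mem (ω : (Fin d → Bool) × Bool) : recordPoint ω ∈ dataUniverse d 2 :=
  ⟨signPoint_mem _, by simp [recordPoint]⟩

/-- The law of `(x, y)` in the instance with binary responses. -/
def recordLaw (θ : EuclideanSpace ℝ (Fin d)) : Measure (Record d) :=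
  ∑ ω : (Fin d → Bool) × Bool, ENNReal.ofReal (wt θ ω) • Measure.dirac (recordPoint ω)

lemma sum_ofReal_wt {θ : EuclideanSpace ℝ (Fin d)} (hθ : ∑ i, |θ i| ≤ 1) :
    ∑ ω, ENNReal.ofReal (wt θ ω) = 1 := by
  rw [← ENNReal.ofReal_sum_of_nonneg fun ω _ => wt_nonneg hθ ω, sum_wt, ENNReal.ofReal_one]

lemma isProbabilityMeasure_recordLaw {θ : EuclideanSpace ℝ (Fin d)} (hθ : ∑ i, |θ i| ≤ 1) :
    IsProbabilityMeasure (recordLaw θ) :=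
  ⟨by simp [recordLaw, Measure.finsetSum_apply, sum_ofReal_wt hθ]⟩

lemma map_sum_dirac {α β ι : Type*} [MeasurableSpace α] [MeasurableSpace β] [Fintype ι]
    (c : ι → ℝ≥0∞) (a : ι → α) {f : α → β} (hf : Measurable f) :
    (∑ i, c i • Measure.dirac (a i)).map f = ∑ i, c i • Measure.dirac (f (a i)) := by
  ext s hs
  rw [Measure.map_apply hf hs, Measure.finsetSum_apply, Measure.finsetSum_apply]
  refine Finset.sum_congr rfl fun i _ => ?_
  rw [Measure.smul_apply, Measure.smul_apply, Measure.dirac_apply' _ hs,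
    Measure.dirac_apply' _ (hf hs)]
  rfl

/-- Given `x`, the response is a sign with mean `⟨θ, x⟩`, so the noise is centered; it is at most `1
+ ‖θ‖₁ ≤ 2` in absolute value. The weights of the two responses add up to `2^{-d}`, which makes the
design uniform. -/
lemma isDesignNoiseLaw_designLaw {θ : EuclideanSpace ℝ (Fin d)} (hθ : ∑ i, |θ i| ≤ 1) :
    IsDesignNoiseLaw d 2 (designLaw θ) := by
  have hP : IsProbabilityMeasure (designLaw θ) :=
    ⟨by simp [designLaw, Measure.finsetSum_apply, sum_ofReal_wt hθ]⟩
  have hb : ∀ᵐ w ∂(designLaw θ), |w.2| ≤ 2 := by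
    have hm : MeasurableSet {w : EuclideanSpace ℝ (Fin d) × ℝ | |w.2| ≤ 2} :=
      measurableSet_le (by fun_prop) measurable_const
    rw [ae_iff, designLaw, Measure.finsetSum_apply]
    refine Finset.sum_eq_zero fun ω _ => ?_
    change ENNReal.ofReal (wt θ ω) •
      Measure.dirac _ {w : EuclideanSpace ℝ (Fin d) × ℝ | |w.2| ≤ 2}ᶜ = 0
    rw [Measure.dirac_apply' _ hm.compl, Set.indicator_of_notMem, smul_zero]
    have h := abs_le.mp ((abs_inner_signPoint_le θ ω.1).trans hθ)
    have h2 := abs_le.mp (abs_sgn ω.2).le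
    simp only [Set.mem_compl_iff, Set.mem_ofPred_eq, not_not, abs_le]
    constructor <;> linarith
  refine ⟨hP, ?_, hb, ?_⟩
  · rw [designLaw, map_sum_dirac _ _ measurable_fst, uniformOn_signCube, Fintype.sum_prod_type]
    refine Finset.sum_congr rfl fun b _ => ?_
    dsimp only
    rw [← Finset.sum_smul,
      ← ENNReal.ofReal_sum_of_nonneg fun ω _ => wt_nonneg hθ (b, ω)]
    congr 2
    simp [wt]; field_simp; ring
  · have hint : Integrable (Prod.snd : EuclideanSpace ℝ (Fin d) × ℝ → ℝ) (designLaw θ) :=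
      Integrable.of_bound measurable_snd.aestronglyMeasurable 2 hb
    refine (ae_eq_condExp_of_forall_setIntegral_eq measurable_fst.comap_le hint
      (fun s _ _ => integrableOn_zero) ?_ aestronglyMeasurable_zero).symm
    rintro s ⟨T, hT, rfl⟩ -
    simp only [integral_zero]
    symm
    rw [← integral_indicator (measurable_fst hT), designLaw, integral_finsetSum_measure]
    · simp_rw [integral_smul_measure, integral_dirac, Fintype.sum_prod_type]
      refine Finset.sum_eq_zero fun b _ => ?_
      simp only [ENNReal.toReal_ofReal (wt_nonneg hθ _)]
      by_cases hbT : signPoint b ∈ T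
      · simp [Set.indicator, hbT, wt]; ring
      · simp [Set.indicator, hbT]
    · intro ω _
      exact (integrable_dirac (by simp)).smul_measure ENNReal.ofReal_ne_top

lemma inClass_recordLaw {k : ℕ} {θ : EuclideanSpace ℝ (Fin d)} (hθ : ∑ i, |θ i| ≤ 1)
    (hk : {i | θ i ≠ 0}.ncard ≤ k) : InClass k d 2 θ (recordLaw θ) := by
  refine ⟨hθ, hk, designLaw θ, isDesignNoiseLaw_designLaw hθ, ?_⟩
  rw [designLaw, map_sum_dirac _ _ (by fun_prop)]
  simp [recordLaw, recordPoint]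

/-- Bessel's inequality for the coordinate functions on the sign cube. -/
lemma norm_sq_average_smul_signPoint_le (h : (Fin d → Bool) → ℝ) {B : ℝ} (hB : ∀ b, |h b| ≤ B) :
    ‖(2 ^ d : ℝ)⁻¹ • ∑ b, h b • signPoint b‖ ^ 2 ≤ B ^ 2 := by
  set a := (2 ^ d : ℝ)⁻¹ • ∑ b, h b • signPoint b with ha
  -- The vector `a` lists the degree-one Fourier coefficients of `h`, so `⟨a, x⟩` is the orthogonal
  -- projection of `h` onto the span of the coordinate functions.
  have h1 : ∑ b, h b * inner ℝ a (signPoint b) = 2 ^ d * ‖a‖ ^ 2 := by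
    have : (2 ^ d : ℝ) • a = ∑ b, h b • signPoint b := by
      rw [ha, smul_inv_smul₀ (by positivity)]
    rw [← real_inner_self_eq_norm_sq, ← inner_smul_right a a (2 ^ d : ℝ), this, inner_sum]
    simp [inner_smul_right]
  have h2 : ∑ b, inner ℝ a (signPoint b) ^ 2 = 2 ^ d * ‖a‖ ^ 2 := by
    have := card_mul_sum_pi_sq (J := Fin d) (S := Bool) (fun i s => sgn s * a i) (by simp)
    simp only [Fintype.card_bool, Fintype.card_fin, mul_pow, sgn_sq, one_mul, Finset.sum_const,
      Finset.card_univ, nsmul_eq_mul, Nat.cast_ofNat, ← Finset.mul_sum] at this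
    rw [EuclideanSpace.norm_sq_eq]
    simp only [PiLp.inner_apply, RCLike.inner_apply, conj_trivial, signPoint_apply,
      Real.norm_eq_abs, sq_abs]
    linarith
  have h3 : 0 ≤ ∑ b, (h b - inner ℝ a (signPoint b)) ^ 2 :=
    Finset.sum_nonneg fun b _ => sq_nonneg _
  have h4 : ∑ b, (h b - inner ℝ a (signPoint b)) ^ 2 =
      ∑ b, h b ^ 2 - 2 * ∑ b, h b * inner ℝ a (signPoint b) +
        ∑ b, inner ℝ a (signPoint b) ^ 2 := by
    rw [Finset.mul_sum, ← Finset.sum_sub_distrib, ← Finset.sum_add_distrib]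
    exact Finset.sum_congr rfl fun b _ => by ring
  have h5 : ∑ b : Fin d → Bool, h b ^ 2 ≤ 2 ^ d * B ^ 2 := by
    calc ∑ b : Fin d → Bool, h b ^ 2 ≤ ∑ _b : Fin d → Bool, B ^ 2 :=
          Finset.sum_le_sum fun b _ => sq_le_sq.mpr ((hB b).trans (le_abs_self B))
      _ = _ := by simp
  have hp : (0 : ℝ) < 2 ^ d := by positivity
  refine le_of_mul_le_mul_left ?_ hp
  linarith

end Instance

-- Densities of private messages.

section Density

/-- Setwise domination passes to the Radon–Nikodym derivative almost everywhere. -/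
lemma exists_density_of_le_of_le {Z : Type*} [MeasurableSpace Z] (μ ν : Measure Z)
    [IsFiniteMeasure μ] [IsFiniteMeasure ν] {c C : ℝ} (hc : 0 ≤ c) (hcC : c ≤ C)
    (hl : ∀ S, MeasurableSet S → ENNReal.ofReal c * ν S ≤ μ S)
    (hu : ∀ S, MeasurableSet S → μ S ≤ ENNReal.ofReal C * ν S) :
    ∃ g : Z → ℝ, Measurable g ∧ (∀ z, c ≤ g z ∧ g z ≤ C) ∧
      μ = ν.withDensity fun z => ENNReal.ofReal (g z) := by
  have hac : μ ≪ ν := by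
    refine Measure.AbsolutelyContinuous.mk fun S hS h0 => ?_
    simpa [h0] using hu S hS
  have hd := Measure.withDensity_rnDeriv_eq μ ν hac
  have hmr := Measure.measurable_rnDeriv μ ν
  have hμ : ∀ S, MeasurableSet S → ∫⁻ z in S, μ.rnDeriv ν z ∂ν = μ S := fun S hS => by
    rw [← withDensity_apply _ hS, hd]
  have h1 : (fun _ => ENNReal.ofReal c) ≤ᵐ[ν] μ.rnDeriv ν :=
    ae_le_of_forall_setLIntegral_le_of_sigmaFinite measurable_const fun S hS _ => by
      rw [hμ S hS, setLIntegral_const]; exact hl S hS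
  have h2 : μ.rnDeriv ν ≤ᵐ[ν] fun _ => ENNReal.ofReal C :=
    ae_le_of_forall_setLIntegral_le_of_sigmaFinite hmr fun S hS _ => by
      rw [hμ S hS, setLIntegral_const]; exact hu S hS
  -- Clipping to `[c, C]` makes the bounds hold everywhere and changes the derivative only on a null
  -- set.
  refine ⟨fun z => max c (min C (μ.rnDeriv ν z).toReal), by fun_prop,
    fun z => ⟨le_max_left _ _, max_le hcC (min_le_left _ _)⟩, ?_⟩
  conv_lhs => rw [← hd]
  refine withDensity_congr_ae ?_
  filter_upwards [h1, h2] with z hz1 hz2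
  have hne : μ.rnDeriv ν z ≠ ∞ := ne_top_of_le_ne_top ENNReal.ofReal_ne_top hz2
  rw [min_eq_right, max_eq_right, ENNReal.ofReal_toReal hne]
  · exact (ENNReal.ofReal_le_iff_le_toReal hne).mp hz1
  · exact ENNReal.toReal_le_of_le_ofReal (hc.trans hcC) hz2

variable {d : ℕ} {Z : Type*} [MeasurableSpace Z]

lemma bind_recordLaw_apply (θ : EuclideanSpace ℝ (Fin d)) (Q : Kernel (Record d) Z) (S : Set Z)
    (hS : MeasurableSet S) : (recordLaw θ).bind Q S =
      ∑ ω, ENNReal.ofReal (wt θ ω) * Q (recordPoint ω) S := by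
  rw [Measure.bind_apply hS Q.aemeasurable, recordLaw, lintegral_finsetSum_measure]
  refine Finset.sum_congr rfl fun ω _ => ?_
  rw [lintegral_smul_measure, lintegral_dirac' _ (Q.measurable_coe hS), smul_eq_mul]

lemma sum_abs_zero_le : ∑ i, |(0 : EuclideanSpace ℝ (Fin d)) i| ≤ 1 := by simp

lemma isProbabilityMeasure_bind_recordLaw {θ : EuclideanSpace ℝ (Fin d)} (hθ : ∑ i, |θ i| ≤ 1)
    (Q : Kernel (Record d) Z) [IsMarkovKernel Q] :
    IsProbabilityMeasure ((recordLaw θ).bind Q) :=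
  ⟨by rw [bind_recordLaw_apply _ _ _ MeasurableSet.univ]; simp [sum_ofReal_wt hθ]⟩

/-- The density of the message law under `recordLaw θ`, given the densities `g` of the messages of
the individual records. -/
def mixDensity {Y : Type*} (g : (Fin d → Bool) × Bool → Y → ℝ)
    (θ : EuclideanSpace ℝ (Fin d)) (z : Y) : ℝ :=
  ∑ ω, wt θ ω * g ω z

lemma mixDensity_bounds {Y : Type*} {g : (Fin d → Bool) × Bool → Y → ℝ} {c C : ℝ}
    (hg : ∀ ω z, c ≤ g ω z ∧ g ω z ≤ C) {θ : EuclideanSpace ℝ (Fin d)} (hθ : ∑ i, |θ i| ≤ 1)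
    (z : Y) : c ≤ mixDensity g θ z ∧ mixDensity g θ z ≤ C := by
  constructor
  · calc c = ∑ ω, wt θ ω * c := by rw [← Finset.sum_mul, sum_wt, one_mul]
      _ ≤ _ := Finset.sum_le_sum fun ω _ =>
        mul_le_mul_of_nonneg_left (hg ω z).1 (wt_nonneg hθ ω)
  · calc mixDensity g θ z ≤ ∑ ω, wt θ ω * C := Finset.sum_le_sum fun ω _ =>
        mul_le_mul_of_nonneg_left (hg ω z).2 (wt_nonneg hθ ω)
      _ = C := by rw [← Finset.sum_mul, sum_wt, one_mul]

lemma bind_recordLaw_eq_withDensity {N : Measure Z} {g : (Fin d → Bool) × Bool → Z → ℝ}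
    {Q : Kernel (Record d) Z} (hgm : ∀ ω, Measurable (g ω)) (hg0 : ∀ ω z, 0 ≤ g ω z)
    (hg : ∀ ω, Q (recordPoint ω) = N.withDensity fun z => ENNReal.ofReal (g ω z))
    {θ : EuclideanSpace ℝ (Fin d)} (hθ : ∑ i, |θ i| ≤ 1) :
    (recordLaw θ).bind Q = N.withDensity fun z => ENNReal.ofReal (mixDensity g θ z) := by
  ext S hS
  rw [bind_recordLaw_apply _ _ _ hS, withDensity_apply _ hS]
  simp_rw [mixDensity]
  have h1 : ∀ z, ENNReal.ofReal (∑ ω, wt θ ω * g ω z) =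
      ∑ ω, ENNReal.ofReal (wt θ ω) * ENNReal.ofReal (g ω z) := by
    intro z
    rw [ENNReal.ofReal_sum_of_nonneg fun ω _ => mul_nonneg (wt_nonneg hθ ω) (hg0 ω z)]
    exact Finset.sum_congr rfl fun ω _ => ENNReal.ofReal_mul (wt_nonneg hθ ω)
  simp_rw [h1]
  rw [lintegral_finsetSum _ fun ω _ => (hgm ω).ennreal_ofReal.const_mul _]
  refine Finset.sum_congr rfl fun ω _ => ?_
  rw [lintegral_const_mul _ (hgm ω).ennreal_ofReal, hg, withDensity_apply _ hS]

/-- The weights `wt θ` are affine in `θ`, so the difference is linear in `θ`, with a coefficient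
vector determined by the message alone. -/
lemma mixDensity_sub_zero {Y : Type*} (g : (Fin d → Bool) × Bool → Y → ℝ) (θ : EuclideanSpace ℝ (Fin d))
    (z : Y) : mixDensity g θ z - mixDensity g 0 z =
      inner ℝ θ ((2 ^ d : ℝ)⁻¹ •
        ∑ b, ((g (b, true) z - g (b, false) z) / 2) • signPoint b) := by
  rw [inner_smul_right, inner_sum, mixDensity, mixDensity, ← Finset.sum_sub_distrib,
    Fintype.sum_prod_type, Finset.mul_sum]
  refine Finset.sum_congr rfl fun b _ => ?_
  simp [wt, inner_smul_right]
  field_simp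
  ring

/-- The second-moment bound of the family is combined with Bessel's inequality, at each fixed
message. -/
lemma sum_mixDensity_sub_sq_le {Y : Type*} {q m : ℕ} (ι : Fin q × Fin m ↪ Fin d) (τ : ℝ) (hm : 0 < m)
    {g : (Fin d → Bool) × Bool → Y → ℝ} {ε : ℝ} (hε : 0 ≤ ε) (hε1 : ε ≤ 1)
    (hg : ∀ ω z, Real.exp (-ε) ≤ g ω z ∧ g ω z ≤ Real.exp ε) (z : Y) :
    ∑ v, (mixDensity g (sparseVec ι τ v) z - mixDensity g 0 z) ^ 2 ≤
      Fintype.card (Fin q → Fin m × Bool) * (τ ^ 2 / m * (2 * ε) ^ 2) := by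
  simp_rw [mixDensity_sub_zero]
  refine (sum_inner_sparseVec_sq_le ι τ hm _).trans ?_
  refine mul_le_mul_of_nonneg_left (mul_le_mul_of_nonneg_left ?_ (by positivity)) (by positivity)
  refine norm_sq_average_smul_signPoint_le _ fun b => ?_
  have h1 := hg (b, true) z
  have h2 := hg (b, false) z
  -- With `e^{-ε} ≥ 1 - ε`, the half-difference of two densities is at most `3ε/2`, hence at most
  -- `2ε`.
  have h3 : Real.exp ε ≤ 1 + 2 * ε := by
    have := Real.abs_exp_sub_one_le (x := ε) (by rw [abs_of_nonneg hε]; exact hε1)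
    rw [abs_of_nonneg hε] at this
    linarith [(abs_le.mp this).2]
  have h4 := Real.add_one_le_exp (-ε)
  rw [abs_le]
  constructor <;> linarith [h1.1, h1.2, h2.1, h2.2]

/-- The message laws of a private channel under `recordLaw (sparseVec ι τ v)` have densities with
respect to one probability measure, and are close to it on average over `v`. -/
lemma exists_channel_densities {q m : ℕ} (ι : Fin q × Fin m ↪ Fin d) {τ : ℝ} (hm : 0 < m)
    (hτ0 : 0 ≤ τ) (hτ : q * τ ≤ 1) {ε : ℝ} (hε : 0 ≤ ε) (hε1 : ε ≤ 1)
    (Q : Kernel (Record d) Z) [IsMarkovKernel Q]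
    (hQ : ∀ v ∈ dataUniverse d 2, ∀ v' ∈ dataUniverse d 2, ∀ S : Set Z, MeasurableSet S →
      Q v S ≤ ENNReal.ofReal (Real.exp ε) * Q v' S) :
    ∃ (N : Measure Z) (f : (Fin q → Fin m × Bool) → Z → ℝ), IsProbabilityMeasure N ∧
      (∀ v, Measurable (f v)) ∧ (∀ v z, Real.exp (-ε) ≤ f v z ∧ f v z ≤ Real.exp ε) ∧
      (∀ v, (recordLaw (sparseVec ι τ v)).bind Q =
        N.withDensity fun z => ENNReal.ofReal (f v z)) ∧
      ∑ v, ∫ z, (f v z - 1) ^ 2 ∂N ≤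
        Fintype.card (Fin q → Fin m × Bool) * (τ ^ 2 / m * (2 * ε) ^ 2) := by
  have hθ : ∀ v, ∑ i, |sparseVec ι τ v i| ≤ 1 := fun v =>
    (sum_abs_sparseVec_le ι τ hτ0 v).trans hτ
  set N : Measure Z := (recordLaw (0 : EuclideanSpace ℝ (Fin d))).bind Q with hN
  have hNP : IsProbabilityMeasure N := isProbabilityMeasure_bind_recordLaw sum_abs_zero_le Q
  have hw := sum_ofReal_wt (sum_abs_zero_le (d := d))
  have hdens : ∀ ω, ∃ g : Z → ℝ, Measurable g ∧
      (∀ z, Real.exp (-ε) ≤ g z ∧ g z ≤ Real.exp ε) ∧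
      Q (recordPoint ω) = N.withDensity fun z => ENNReal.ofReal (g z) := by
    intro ω
    refine exists_density_of_le_of_le _ N (Real.exp_pos _).le
      (Real.exp_le_exp.mpr (by linarith)) (fun S hS => ?_) fun S hS => ?_
    · have h1 : N S ≤ ENNReal.ofReal (Real.exp ε) * Q (recordPoint ω) S := by
        rw [hN, bind_recordLaw_apply _ _ _ hS]
        calc _ ≤ ∑ ω', ENNReal.ofReal (wt (0 : EuclideanSpace ℝ (Fin d)) ω') *
              (ENNReal.ofReal (Real.exp ε) * Q (recordPoint ω) S) :=
              Finset.sum_le_sum fun ω' _ => mul_le_mul_right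
                (hQ _ (recordPoint_mem ω') _ (recordPoint_mem ω) S hS) _
          _ = _ := by rw [← Finset.sum_mul, hw, one_mul]
      calc _ ≤ ENNReal.ofReal (Real.exp (-ε)) *
            (ENNReal.ofReal (Real.exp ε) * Q (recordPoint ω) S) := by gcongr
        _ = _ := by
          rw [← mul_assoc, ← ENNReal.ofReal_mul (Real.exp_pos _).le, ← Real.exp_add]
          simp
    · rw [hN, bind_recordLaw_apply _ _ _ hS]
      calc Q (recordPoint ω) S
          = ∑ ω', ENNReal.ofReal (wt (0 : EuclideanSpace ℝ (Fin d)) ω') *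
              Q (recordPoint ω) S := by rw [← Finset.sum_mul, hw, one_mul]
        _ ≤ ∑ ω', ENNReal.ofReal (wt (0 : EuclideanSpace ℝ (Fin d)) ω') *
              (ENNReal.ofReal (Real.exp ε) * Q (recordPoint ω') S) :=
            Finset.sum_le_sum fun ω' _ => mul_le_mul_right
                (hQ _ (recordPoint_mem ω) _ (recordPoint_mem ω') S hS) _
        _ = _ := by
          rw [Finset.mul_sum]
          exact Finset.sum_congr rfl fun ω' _ => by ring
  choose g hgm hgb hgd using hdens
  have hg0 : ∀ ω z, 0 ≤ g ω z := fun ω z => (Real.exp_pos _).le.trans (hgb ω z).1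
  have hmm : ∀ θ, Measurable (mixDensity g θ) := fun θ =>
    Finset.measurable_sum _ fun ω _ => (hgm ω).const_mul _
  -- `N` is itself the mixture at `θ = 0`. The chosen densities are versions, so the equality is
  -- only almost everywhere.
  have hone : ∀ᵐ z ∂N, mixDensity g 0 z = 1 := by
    have h := bind_recordLaw_eq_withDensity hgm hg0 hgd (sum_abs_zero_le (d := d))
    rw [← hN] at h
    have h2 : (1 : Z → ℝ≥0∞) =ᵐ[N] fun z => ENNReal.ofReal (mixDensity g 0 z) := by
      refine (withDensity_eq_iff measurable_one.aemeasurable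
        (hmm 0).ennreal_ofReal.aemeasurable ?_).mp ?_
      · simp
      · rw [withDensity_one, ← h]
    filter_upwards [h2] with z hz
    exact (ENNReal.ofReal_eq_one.mp hz.symm)
  refine ⟨N, fun v => mixDensity g (sparseVec ι τ v), hNP, fun v => hmm _,
    fun v z => mixDensity_bounds hgb (hθ v) z,
    fun v => bind_recordLaw_eq_withDensity hgm hg0 hgd (hθ v), ?_⟩
  have h1 : ∀ v, ∫ z, (mixDensity g (sparseVec ι τ v) z - 1) ^ 2 ∂N =
      ∫ z, (mixDensity g (sparseVec ι τ v) z - mixDensity g 0 z) ^ 2 ∂N := fun v =>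
    integral_congr_ae (by filter_upwards [hone] with z hz; rw [hz])
  simp_rw [h1]
  have hint : ∀ v, Integrable
      (fun z => (mixDensity g (sparseVec ι τ v) z - mixDensity g 0 z) ^ 2) N := by
    intro v
    refine Integrable.of_bound (((hmm _).sub (hmm _)).pow_const 2).aestronglyMeasurable
      (Real.exp ε ^ 2) (Filter.Eventually.of_forall fun z => ?_)
    have h2 := mixDensity_bounds hgb (hθ v) z
    have h3 := mixDensity_bounds hgb (sum_abs_zero_le (d := d)) z
    have h4 := Real.exp_pos (-ε)
    rw [Real.norm_eq_abs, abs_of_nonneg (sq_nonneg _)]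
    refine sq_le_sq.mpr (le_trans ?_ (le_abs_self _))
    rw [abs_le]
    constructor <;> linarith [h2.1, h2.2, h3.1, h3.2]
  rw [← integral_finsetSum _ fun v _ => hint v]
  calc _ ≤ ∫ _z, (Fintype.card (Fin q → Fin m × Bool) * (τ ^ 2 / m * (2 * ε) ^ 2) : ℝ) ∂N :=
        integral_mono (integrable_finsetSum _ fun v _ => hint v) (integrable_const _)
          fun z => sum_mixDensity_sub_sq_le ι τ hm hε hε1 hgb z
    _ = _ := by simp

end Density

-- Product laws and the law of the transcript.

section Product

variable {I : Type*} [Fintype I] {Z : I → Type*} [∀ i, MeasurableSpace (Z i)]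

lemma pi_withDensity_ofReal (N : ∀ i, Measure (Z i)) [∀ i, IsProbabilityMeasure (N i)]
    {f : ∀ i, Z i → ℝ} (hf0 : ∀ i z, 0 ≤ f i z)
    (hfi : ∀ i, Integrable (f i) (N i)) :
    Measure.pi (fun i => (N i).withDensity fun z => ENNReal.ofReal (f i z)) =
      (Measure.pi N).withDensity fun z => ENNReal.ofReal (∏ i, f i (z i)) := by
  have hfin : ∀ i, IsFiniteMeasure ((N i).withDensity fun z => ENNReal.ofReal (f i z)) :=
    fun i => isFiniteMeasure_withDensity_ofReal (hfi i).2
  refine Measure.pi_eq fun s hs => ?_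
  have hbox : MeasurableSet (Set.univ.pi s) := MeasurableSet.univ_pi hs
  rw [withDensity_apply _ hbox, ← lintegral_indicator hbox]
  have h1 : ∀ z : ∀ i, Z i, (Set.univ.pi s).indicator
      (fun z => ENNReal.ofReal (∏ i, f i (z i))) z =
      ENNReal.ofReal (∏ i, (s i).indicator (f i) (z i)) := by
    intro z
    by_cases hz : z ∈ Set.univ.pi s
    · rw [Set.indicator_of_mem hz]
      congr 1
      exact Finset.prod_congr rfl fun i _ => by
        rw [Set.indicator_of_mem (hz i (Set.mem_univ i))]
    · rw [Set.indicator_of_notMem hz]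
      simp only [Set.mem_pi, Set.mem_univ, true_imp_iff, not_forall] at hz
      obtain ⟨i, hi⟩ := hz
      rw [Finset.prod_eq_zero (Finset.mem_univ i) (Set.indicator_of_notMem hi _),
        ENNReal.ofReal_zero]
  have hi0 : ∀ i z, 0 ≤ (s i).indicator (f i) z := fun i z =>
    Set.indicator_nonneg (fun z _ => hf0 i z) z
  have hii : ∀ i, Integrable ((s i).indicator (f i)) (N i) := fun i => (hfi i).indicator (hs i)
  simp_rw [h1]
  rw [← ofReal_integral_eq_lintegral_ofReal (Integrable.fintype_prod_dep hii)
    (Filter.Eventually.of_forall fun z => Finset.prod_nonneg fun i _ => hi0 i _),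
    integral_fintype_prod_eq_prod (fun i => (s i).indicator (f i)),
    ENNReal.ofReal_prod_of_nonneg fun i _ => integral_nonneg (hi0 i)]
  refine Finset.prod_congr rfl fun i _ => ?_
  rw [withDensity_apply _ (hs i), integral_indicator (hs i),
    ofReal_integral_eq_lintegral_ofReal (hfi i).integrableOn
      (Filter.Eventually.of_forall (hf0 i))]

/-- Independent data passed through independent channels give independent messages: both sides agree
on boxes, by Fubini. -/
lemma pi_bind {X : Type*} [MeasurableSpace X] (P : Measure X) [IsProbabilityMeasure P]
    (Q : ∀ i, Kernel X (Z i)) [∀ i, IsMarkovKernel (Q i)] :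
    Measurable (fun D : I → X => Measure.pi fun i => Q i (D i)) ∧
    (Measure.pi fun _ : I => P).bind (fun D => Measure.pi fun i => Q i (D i)) =
      Measure.pi fun i => P.bind (Q i) := by
  have hmeas : Measurable (fun D : I → X => Measure.pi fun i => Q i (D i)) := by
    refine Measurable.measure_of_isPiSystem_of_isProbabilityMeasure
      generateFrom_pi.symm isPiSystem_pi ?_
    rintro _ ⟨s, hs, rfl⟩
    simp only [Measure.pi_pi]
    exact Finset.measurable_prod _ fun i _ =>
      ((Q i).measurable_coe (hs i (Set.mem_univ i))).comp (measurable_pi_apply i)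
  refine ⟨hmeas, ?_⟩
  have hp : ∀ i, IsProbabilityMeasure (P.bind (Q i)) := fun i => by
    refine ⟨?_⟩
    rw [Measure.bind_apply MeasurableSet.univ (Q i).aemeasurable]
    simp
  refine (Measure.pi_eq fun s hs => ?_).symm
  rw [Measure.bind_apply (MeasurableSet.univ_pi hs) hmeas.aemeasurable]
  simp only [Measure.pi_pi]
  have hle : ∀ i x, Q i x (s i) ≤ 1 := fun i x => prob_le_one
  have hint : ∀ i, Integrable (fun x => (Q i x (s i)).toReal) P := fun i =>
    Integrable.of_bound ((Q i).measurable_coe (hs i)).ennreal_toReal.aestronglyMeasurable 1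
      (Filter.Eventually.of_forall fun x => by
        rw [Real.norm_eq_abs, abs_of_nonneg ENNReal.toReal_nonneg]
        exact ENNReal.toReal_le_of_le_ofReal zero_le_one (by simpa using hle i x))
  have h1 : ∀ D : I → X, ∏ i, Q i (D i) (s i) =
      ENNReal.ofReal (∏ i, (Q i (D i) (s i)).toReal) := by
    intro D
    rw [← ENNReal.toReal_prod, ENNReal.ofReal_toReal]
    exact ENNReal.prod_ne_top fun i _ => measure_ne_top _ _
  simp_rw [h1]
  rw [← ofReal_integral_eq_lintegral_ofReal (Integrable.fintype_prod_dep hint)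
    (Filter.Eventually.of_forall fun z => Finset.prod_nonneg fun i _ => ENNReal.toReal_nonneg),
    integral_fintype_prod_eq_prod (fun i x => (Q i x (s i)).toReal),
    ENNReal.ofReal_prod_of_nonneg fun i _ => integral_nonneg fun x => ENNReal.toReal_nonneg]
  refine Finset.prod_congr rfl fun i _ => ?_
  rw [Measure.bind_apply (hs i) (Q i).aemeasurable, integral_toReal
    ((Q i).measurable_coe (hs i)).aemeasurable
    (Filter.Eventually.of_forall fun x => measure_lt_top _ _), ENNReal.ofReal_toReal]
  refine ne_top_of_le_ne_top ENNReal.one_ne_top ?_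
  calc ∫⁻ x, Q i x (s i) ∂P ≤ ∫⁻ _x, 1 ∂P := lintegral_mono fun x => hle i x
    _ = 1 := by simp

end Product

/-- Integrating out the data first reduces the error to a product law of messages. -/
lemma expectedError_eq {n d : ℕ} (A : NonInteractiveAlgorithm.{u} n d) (P : Measure (Record d))
    [IsProbabilityMeasure P] (θ : EuclideanSpace ℝ (Fin d)) :
    A.expectedError P θ = ∫⁻ z, ∫⁻ t, ENNReal.ofReal ‖t - θ‖ ∂(A.estimator z)
      ∂(Measure.pi fun i => P.bind (A.channel i)) := by
  obtain ⟨hm, hb⟩ := pi_bind P A.channel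
  have hmt : Measurable fun t : EuclideanSpace ℝ (Fin d) => ENNReal.ofReal ‖t - θ‖ := by fun_prop
  rw [← hb, Measure.lintegral_bind hm.aemeasurable hmt.lintegral_kernel.aemeasurable]
  refine lintegral_congr fun D => ?_
  rw [NonInteractiveAlgorithm.outputLaw,
    Measure.lintegral_bind A.estimator.aemeasurable hmt.aemeasurable]

/-- Young's inequality for the entropy, with the entropy of a product bounded by a sum. -/
lemma prod_mul_sub_log_le {I : Type*} [Fintype I] {x : I → ℝ} (hx : ∀ i, 0 < x i) (h : ℝ)
    {C : ℝ} (hC : 0 < C) :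
    (∏ i, x i) * (h - Real.log C) ≤
      (∏ i, x i) * ∑ i, (x i - 1) - (∏ i, x i) + Real.exp h / C := by
  set F := ∏ i, x i with hF
  have hFpos : 0 < F := Finset.prod_pos fun i _ => hx i
  have hlog : Real.log F ≤ ∑ i, (x i - 1) := by
    rw [hF, Real.log_prod fun i _ => (hx i).ne']
    exact Finset.sum_le_sum fun i _ => Real.log_le_sub_one_of_pos (hx i)
  -- This is `x + 1 ≤ e^x` at `x = h - log C - log F`; multiplying by `F` gives the duality bound.
  have h1 : h - Real.log C - Real.log F + 1 ≤ Real.exp h / C / F := by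
    have := Real.add_one_le_exp (h - Real.log C - Real.log F)
    rwa [Real.exp_sub, Real.exp_sub, Real.exp_log hC, Real.exp_log hFpos] at this
  have h2 := mul_le_mul_of_nonneg_left h1 hFpos.le
  rw [mul_div_cancel₀ _ hFpos.ne'] at h2
  nlinarith [mul_le_mul_of_nonneg_left hlog hFpos.le]

lemma integral_fst_compProd {X T : Type*} [MeasurableSpace X] [MeasurableSpace T]
    {μ : Measure X} [IsProbabilityMeasure μ] {K : Kernel X T} [IsMarkovKernel K] {g : X → ℝ}
    (hg : Measurable g) : ∫ w, g w.1 ∂(μ ⊗ₘ K) = ∫ x, g x ∂μ := by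
  have hmap : (μ ⊗ₘ K).map Prod.fst = μ := Measure.fst_compProd _ _
  conv_rhs => rw [← hmap, integral_map measurable_fst.aemeasurable hg.aestronglyMeasurable]

-- Fano's inequality through entropy duality.

section Fano

variable {I : Type*} [Fintype I] {Z : I → Type*} [∀ i, MeasurableSpace (Z i)]
  {T : Type*} [MeasurableSpace T] {V : Type*} [Fintype V]

/-- A form of Fano's inequality for products of laws `f i v · N i` with bounded densities, the
mutual information being bounded by the sum of the `χ²`-divergences. -/
lemma sum_integral_prod_mul_le (N : ∀ i, Measure (Z i)) [∀ i, IsProbabilityMeasure (N i)]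
    (K : Kernel (∀ i, Z i) T) [IsMarkovKernel K] {f : ∀ i, V → Z i → ℝ}
    (hfm : ∀ i v, Measurable (f i v)) {c B : ℝ} (hc : 0 < c)
    (hfb : ∀ i v z, c ≤ f i v z ∧ f i v z ≤ B) (hf1 : ∀ i v, ∫ z, f i v z ∂(N i) = 1)
    {h : V → T → ℝ} (hhm : ∀ v, Measurable (h v)) {b C : ℝ} (hhb : ∀ v t, |h v t| ≤ b)
    (hC : 0 < C) (hexp : ∀ t, ∑ v, Real.exp (h v t) ≤ Fintype.card V * C) :
    ∑ v, ∫ w, (∏ i, f i v (w.1 i)) * h v w.2 ∂(Measure.pi N ⊗ₘ K) ≤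
      Fintype.card V * Real.log C + ∑ i, ∑ v, ∫ z, (f i v z - 1) ^ 2 ∂(N i) := by
  classical
  set ρ := Measure.pi N ⊗ₘ K with hR
  have hf0 : ∀ i v z, 0 < f i v z := fun i v z => hc.trans_le (hfb i v z).1
  have hfi : ∀ i v, Integrable (f i v) (N i) := fun i v =>
    Integrable.of_bound (hfm i v).aestronglyMeasurable B (Filter.Eventually.of_forall fun z => by
      rw [Real.norm_eq_abs, abs_of_pos (hf0 i v z)]; exact (hfb i v z).2)
  have hFm : ∀ v, Measurable fun w : (∀ i, Z i) × T => ∏ i, f i v (w.1 i) := fun v =>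
    Finset.measurable_prod _ fun i _ =>
      (hfm i v).comp ((measurable_pi_apply i).comp measurable_fst)
  have hFb : ∀ v (z : ∀ i, Z i), |∏ i, f i v (z i)| ≤ ∏ _i : I, B := fun v z => by
    rw [abs_of_pos (Finset.prod_pos fun i _ => hf0 i v _)]
    exact Finset.prod_le_prod (fun i _ => (hf0 i v _).le) fun i _ => (hfb i v _).2
  have hF : ∀ v, Integrable (fun w : (∀ i, Z i) × T => ∏ i, f i v (w.1 i)) ρ := fun v =>
    Integrable.of_bound (hFm v).aestronglyMeasurable _
      (Filter.Eventually.of_forall fun w => hFb v w.1)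
  have hFh : ∀ v, Integrable (fun w : (∀ i, Z i) × T => (∏ i, f i v (w.1 i)) * h v w.2) ρ :=
    fun v => (hF v).mul_bdd (c := b) ((hhm v).comp measurable_snd).aestronglyMeasurable
      (Filter.Eventually.of_forall fun w => hhb v w.2)
  have hFf : ∀ v i, Integrable
      (fun w : (∀ i, Z i) × T => (∏ j, f j v (w.1 j)) * (f i v (w.1 i) - 1)) ρ := by
    intro v i
    refine (hF v).mul_bdd (c := B + 1) (((hfm i v).comp
      ((measurable_pi_apply i).comp measurable_fst)).sub_const 1).aestronglyMeasurable
      (Filter.Eventually.of_forall fun w => ?_)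
    have := hfb i v (w.1 i)
    rw [Real.norm_eq_abs, abs_le]
    constructor <;> linarith
  have hF1 : ∀ v, ∫ w, ∏ i, f i v (w.1 i) ∂ρ = 1 := fun v => by
    rw [hR, integral_fst_compProd (g := fun z : ∀ i, Z i => ∏ i, f i v (z i)) (Finset.measurable_prod _ fun i _ =>
      (hfm i v).comp (measurable_pi_apply i)),
      integral_fintype_prod_eq_prod (fun i => f i v)]
    simp [hf1]
  -- The other factors integrate to `1`, and `∫ f(f - 1) = ∫ (f - 1)²` because `∫ f = 1`.
  have hFG : ∀ v i, ∫ w, (∏ j, f j v (w.1 j)) * (f i v (w.1 i) - 1) ∂ρ =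
      ∫ z, (f i v z - 1) ^ 2 ∂(N i) := by
    intro v i
    rw [hR, integral_fst_compProd (g := fun z : ∀ i, Z i => (∏ j, f j v (z j)) * (f i v (z i) - 1))
      ((Finset.measurable_prod _ fun i _ => (hfm i v).comp (measurable_pi_apply i)).mul
        (((hfm i v).comp (measurable_pi_apply i)).sub_const 1))]
    have h1 : ∀ z : ∀ i, Z i, (∏ j, f j v (z j)) * (f i v (z i) - 1) =
        ∏ j, (f j v (z j) * if j = i then f j v (z j) - 1 else 1) := by
      intro z; rw [Finset.prod_mul_distrib]; simp
    simp_rw [h1]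
    rw [integral_fintype_prod_eq_prod
      (fun j z => f j v z * if j = i then f j v z - 1 else 1),
      ← Finset.mul_prod_erase _ _ (Finset.mem_univ i), Finset.prod_eq_one, mul_one]
    · simp only [if_true]
      have h2 : ∀ z, (f i v z - 1) ^ 2 = f i v z * (f i v z - 1) - (f i v z - 1) := fun z => by
        ring
      simp_rw [h2]
      rw [integral_sub, integral_sub (hfi i v) (integrable_const _), hf1]
      · simp
      · refine (hfi i v).mul_bdd (c := B + 1) ((hfm i v).sub_const 1).aestronglyMeasurable
          (Filter.Eventually.of_forall fun z => ?_)
        have := hfb i v z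
        rw [Real.norm_eq_abs, abs_le]
        constructor <;> linarith
      · exact (hfi i v).sub (integrable_const _)
    · intro j hj
      simp [Finset.ne_of_mem_erase hj, hf1]
  have hpt : ∀ w : (∀ i, Z i) × T, ∑ v, (∏ i, f i v (w.1 i)) * h v w.2 ≤
      ∑ v, (Real.log C * (∏ i, f i v (w.1 i)) +
        ∑ i, (∏ j, f j v (w.1 j)) * (f i v (w.1 i) - 1) - ∏ i, f i v (w.1 i)) +
      Fintype.card V := by
    intro w
    have h1 : ∑ v, Real.exp (h v w.2) / C ≤ Fintype.card V := by
      rw [← Finset.sum_div, div_le_iff₀ hC]; exact hexp w.2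
    have h2 : ∑ v, (∏ i, f i v (w.1 i)) * h v w.2 ≤
        ∑ v, ((Real.log C * (∏ i, f i v (w.1 i)) +
        ∑ i, (∏ j, f j v (w.1 j)) * (f i v (w.1 i) - 1) - ∏ i, f i v (w.1 i)) +
          Real.exp (h v w.2) / C) := by
      refine Finset.sum_le_sum fun v _ => ?_
      have := prod_mul_sub_log_le (fun i => hf0 i v (w.1 i)) (h v w.2) hC
      rw [Finset.mul_sum] at this
      linarith
    rw [Finset.sum_add_distrib] at h2
    linarith
  have hG : ∀ v, Integrable (fun w : (∀ i, Z i) × T => Real.log C * (∏ i, f i v (w.1 i)) +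
        ∑ i, (∏ j, f j v (w.1 j)) * (f i v (w.1 i) - 1) - ∏ i, f i v (w.1 i)) ρ := fun v =>
    (((hF v).const_mul _).add (integrable_finsetSum _ fun i _ => hFf v i)).sub (hF v)
  have hmono := integral_mono (μ := ρ) (integrable_finsetSum _ fun v _ => hFh v)
    ((integrable_finsetSum Finset.univ fun v _ => hG v).add
      (integrable_const (Fintype.card V : ℝ))) hpt
  rw [integral_finsetSum _ fun v _ => hFh v] at hmono
  refine hmono.trans_eq ?_
  have hsum : ∀ v, ∫ w, (Real.log C * (∏ i, f i v (w.1 i)) +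
        ∑ i, (∏ j, f j v (w.1 j)) * (f i v (w.1 i) - 1) - ∏ i, f i v (w.1 i)) ∂ρ =
      Real.log C - 1 + ∑ i, ∫ z, (f i v z - 1) ^ 2 ∂(N i) := by
    intro v
    have hS := integrable_finsetSum (μ := ρ) Finset.univ fun i _ => hFf v i
    have hLS : Integrable (fun w : (∀ i, Z i) × T => Real.log C * (∏ i, f i v (w.1 i)) +
        ∑ i, (∏ j, f j v (w.1 j)) * (f i v (w.1 i) - 1)) ρ := ((hF v).const_mul _).add hS
    rw [integral_sub hLS (hF v),
      integral_add ((hF v).const_mul _) hS, integral_const_mul, hF1,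
      integral_finsetSum _ fun i _ => hFf v i]
    simp_rw [hFG]
    ring
  simp only [Pi.add_apply]
  rw [integral_add (integrable_finsetSum Finset.univ fun v _ => hG v) (integrable_const _),
    integral_finsetSum _ fun v _ => hG v]
  simp_rw [hsum]
  rw [Finset.sum_add_distrib, Finset.sum_comm (s := Finset.univ (α := I))]
  simp
  ring

end Fano

-- From small error to many users.

section Error

/-- Transfers an error bound under a message law to a real integral against the common reference law
of message and output. -/
lemma ofReal_integral_le_lintegral_withDensity {X T : Type*} [MeasurableSpace X] [MeasurableSpace T]
    {μ : Measure X} [IsProbabilityMeasure μ] {K : Kernel X T} [IsMarkovKernel K]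
    {F : X → ℝ} (hF : Measurable F) (hF0 : ∀ x, 0 ≤ F x) {B : ℝ} (hFB : ∀ x, F x ≤ B)
    {ℓ : T → ℝ} (hℓ : Measurable ℓ) (hℓ0 : ∀ t, 0 ≤ ℓ t) {b : ℝ} (hℓb : ∀ t, ℓ t ≤ b)
    {r : T → ℝ≥0∞} (hr : Measurable r) (hle : ∀ t, ENNReal.ofReal (ℓ t) ≤ r t) :
    ENNReal.ofReal (∫ w, F w.1 * ℓ w.2 ∂(μ ⊗ₘ K)) ≤
      ∫⁻ x, ∫⁻ t, r t ∂(K x) ∂(μ.withDensity fun x => ENNReal.ofReal (F x)) := by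
  have hint : Integrable (fun w : X × T => F w.1 * ℓ w.2) (μ ⊗ₘ K) := by
    refine Integrable.of_bound ((hF.comp measurable_fst).mul
      (hℓ.comp measurable_snd)).aestronglyMeasurable (B * b)
      (Filter.Eventually.of_forall fun w => ?_)
    rw [Real.norm_eq_abs, abs_of_nonneg (mul_nonneg (hF0 _) (hℓ0 _))]
    exact mul_le_mul (hFB _) (hℓb _) (hℓ0 _) ((hF0 w.1).trans (hFB _))
  rw [ofReal_integral_eq_lintegral_ofReal hint
      (Filter.Eventually.of_forall fun w => mul_nonneg (hF0 _) (hℓ0 _)),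
    Measure.lintegral_compProd
      (f := fun w : X × T => ENNReal.ofReal (F w.1 * ℓ w.2))
      ((hF.comp measurable_fst).mul (hℓ.comp measurable_snd)).ennreal_ofReal,
    lintegral_withDensity_eq_lintegral_mul _ hF.ennreal_ofReal hr.lintegral_kernel]
  refine lintegral_mono fun x => ?_
  simp only [Pi.mul_apply]
  rw [← lintegral_const_mul _ hr]
  refine lintegral_mono fun t => ?_
  simp only [ENNReal.ofReal_mul (hF0 x)]
  gcongr
  exact hle t

variable {n d : ℕ}

/-- The information inequality for an algorithm with small error on all the sparse instances. -/
lemma mul_log_le_of_expectedError_le (A : NonInteractiveAlgorithm.{u} n d) {ε : ℝ} (hε : 0 ≤ ε)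
    (hε1 : ε ≤ 1) (hA : A.IsLDP (dataUniverse d 2) ε) {q m : ℕ} (ι : Fin q × Fin m ↪ Fin d)
    (hq : 0 < q) (hm : 2 ≤ m) {τ : ℝ} (hτ0 : 0 < τ) (hτ : q * τ ≤ 1)
    (herr : ∀ v, A.expectedError (recordLaw (sparseVec ι τ v)) (sparseVec ι τ v) ≤
      ENNReal.ofReal (√q * τ / 8)) :
    q * Real.log (2 * m) / 4 ≤ n * (τ ^ 2 / m * (2 * ε) ^ 2) := by
  have hm0 : 0 < m := by omega
  have hθ : ∀ v, ∑ i, |sparseVec ι τ v i| ≤ 1 := fun v =>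
    (sum_abs_sparseVec_le ι τ hτ0.le v).trans hτ
  choose N f hN hfm hfb hfd hfχ using fun i => exists_channel_densities ι hm0 hτ0.le hτ hε hε1
    (A.channel i) (hA i)
  have hf0 : ∀ i v z, 0 ≤ f i v z := fun i v z => (Real.exp_pos _).le.trans (hfb i v z).1
  have hfi : ∀ i v, Integrable (f i v) (N i) := fun i v =>
    Integrable.of_bound (hfm i v).aestronglyMeasurable (Real.exp ε)
      (Filter.Eventually.of_forall fun z => by
        rw [Real.norm_eq_abs, abs_of_nonneg (hf0 i v z)]; exact (hfb i v z).2)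
  have hf1 : ∀ i v, ∫ z, f i v z ∂(N i) = 1 := by
    intro i v
    have h := (isProbabilityMeasure_bind_recordLaw (hθ v) (A.channel i)).measure_univ
    rw [hfd, withDensity_apply _ MeasurableSet.univ, Measure.restrict_univ,
      ← ofReal_integral_eq_lintegral_ofReal (hfi i v)
        (Filter.Eventually.of_forall (hf0 i v))] at h
    exact ENNReal.ofReal_eq_one.mp h
  have hq' : (0 : ℝ) < q := by exact_mod_cast hq
  have hSne : Nonempty (Fin m × Bool) := ⟨(⟨0, hm0⟩, true)⟩
  have hcS : (Fintype.card (Fin m × Bool) : ℝ) = 2 * m := by simp; ring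
  have hm2 : (2 : ℝ) ≤ m := by exact_mod_cast hm
  set L := Real.log (2 * m) with hL
  -- Since `2m ≥ 4`, the cost `q log 2` of the exponential moment absorbs at most half of `qL`.
  have hLlog : 2 * Real.log 2 ≤ L := by
    rw [hL, ← Real.log_rpow (by norm_num)]
    exact Real.log_le_log (by norm_num) (by norm_num; linarith)
  have hlog2 : 0 < Real.log 2 := Real.log_pos (by norm_num)
  have hLpos : 0 < L := by linarith
  -- The test function weighs each near block by `L = log(2m)`, the logarithm of the alphabet size,
  -- so the exponential moment is at most `2 ^ q`.
  have hfano := sum_integral_prod_mul_le N A.estimator hfm (Real.exp_pos (-ε)) hfb hf1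
    (h := fun v t => L * numNear ι τ v t) (b := L * q) (C := 2 ^ q)
    (fun v => (measurable_numNear ι τ v).const_mul L)
    (fun v t => by
      rw [abs_of_nonneg (mul_nonneg hLpos.le (numNear_nonneg ι τ v t))]
      exact mul_le_mul_of_nonneg_left (numNear_le ι τ v t) hLpos.le)
    (by positivity)
    (fun t => by
      have := sum_exp_accepted_le (Near ι τ t) (near_unique ι τ t)
      rw [hcS, Fintype.card_fin, ← hL] at this
      have hcV : (Fintype.card (Fin q → Fin m × Bool) : ℝ) = (2 * m) ^ q := by
        rw [← hcS]; simp
      rw [hcV]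
      exact this)
  set F : (Fin q → Fin m × Bool) → (∀ i, A.Msg i) → ℝ := fun v z => ∏ i, f i v (z i) with hFdef
  have hFm : ∀ v, Measurable (F v) := fun v =>
    Finset.measurable_prod _ fun i _ => (hfm i v).comp (measurable_pi_apply i)
  have hF0 : ∀ v z, 0 ≤ F v z := fun v z => Finset.prod_nonneg fun i _ => hf0 i v _
  have hFB : ∀ v z, F v z ≤ ∏ _i : Fin n, Real.exp ε := fun v z =>
    Finset.prod_le_prod (fun i _ => hf0 i v _) fun i _ => (hfb i v _).2
  set ρ := Measure.pi N ⊗ₘ A.estimator with hρ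
  have hF1 : ∀ v, ∫ w, F v w.1 ∂ρ = 1 := fun v => by
    rw [hρ, integral_fst_compProd (hFm v), hFdef,
      integral_fintype_prod_eq_prod (fun i => f i v)]
    simp [hf1]
  have hFi : ∀ v, Integrable (fun w : (∀ i, A.Msg i) × EuclideanSpace ℝ (Fin d) => F v w.1) ρ :=
    fun v => Integrable.of_bound ((hFm v).comp measurable_fst).aestronglyMeasurable _
      (Filter.Eventually.of_forall fun w => by
        rw [Real.norm_eq_abs, abs_of_nonneg (hF0 v _)]; exact hFB v w.1)
  have hFn : ∀ v, Integrable (fun w : (∀ i, A.Msg i) × EuclideanSpace ℝ (Fin d) =>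
      F v w.1 * numNear ι τ v w.2) ρ := fun v =>
    (hFi v).mul_bdd (c := q) ((measurable_numNear ι τ v).comp measurable_snd).aestronglyMeasurable
      (Filter.Eventually.of_forall fun w => by
        rw [Real.norm_eq_abs, abs_of_nonneg (numNear_nonneg ι τ v _)]; exact numNear_le ι τ v _)
  have hlow : ∀ v, q * (1 - √2 / 8) ≤ ∫ w, F v w.1 * numNear ι τ v w.2 ∂ρ := by
    intro v
    have hκ : 0 < τ / √(2 * q) := by positivity
    have hP := isProbabilityMeasure_recordLaw (hθ v)
    have h1 := ofReal_integral_le_lintegral_withDensity (μ := Measure.pi N) (K := A.estimator) (hFm v) (hF0 v)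
      (hFB v) (ℓ := fun t => τ / √(2 * q) * (q - numNear ι τ v t))
      ((measurable_const.sub (measurable_numNear ι τ v)).const_mul _)
      (fun t => mul_nonneg hκ.le (sub_nonneg.mpr (numNear_le ι τ v t)))
      (b := τ / √(2 * q) * q)
      (fun t => mul_le_mul_of_nonneg_left (by linarith [numNear_nonneg ι τ v t]) hκ.le)
      (r := fun t => ENNReal.ofReal ‖t - sparseVec ι τ v‖) (by fun_prop)
      (fun t => ENNReal.ofReal_le_ofReal (le_norm_sub_sparseVec ι τ hq v t))
    have h2 := herr v
    rw [expectedError_eq] at h2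
    simp_rw [hfd] at h2
    rw [pi_withDensity_ofReal N (fun i => hf0 i v) (fun i => hfi i v)] at h2
    have h3 := (ENNReal.ofReal_le_ofReal_iff (by positivity)).mp (h1.trans h2)
    have h4 : ∫ w, F v w.1 * (τ / √(2 * q) * (q - numNear ι τ v w.2)) ∂ρ =
        τ / √(2 * q) * (q - ∫ w, F v w.1 * numNear ι τ v w.2 ∂ρ) := by
      have h5 : ∀ w : (∀ i, A.Msg i) × EuclideanSpace ℝ (Fin d),
          F v w.1 * (τ / √(2 * q) * (q - numNear ι τ v w.2)) =
          τ / √(2 * q) * (q * F v w.1 - F v w.1 * numNear ι τ v w.2) := fun w => by ring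
      simp_rw [h5]
      rw [integral_const_mul, integral_sub ((hFi v).const_mul _) (hFn v), integral_const_mul, hF1,
        mul_one]
    rw [h4] at h3
    -- In units of the slope `τ/√(2q)`, the allowed error is a fraction `√2/8` of the blocks.
    have h6 : √q * τ / 8 = τ / √(2 * q) * (q * (√2 / 8)) := by
      rw [Real.sqrt_mul (by norm_num)]
      have hsq : √(q : ℝ) * √q = q := Real.mul_self_sqrt hq'.le
      have : 0 < √(q : ℝ) := Real.sqrt_pos.mpr hq'
      field_simp
      linarith [hsq]
    rw [h6] at h3
    linarith [le_of_mul_le_mul_left h3 hκ]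
  have hV : (0 : ℝ) < Fintype.card (Fin q → Fin m × Bool) := by exact_mod_cast Fintype.card_pos
  have hleft : Fintype.card (Fin q → Fin m × Bool) * (L * (q * (1 - √2 / 8))) ≤
      ∑ v, ∫ w, (∏ i, f i v (w.1 i)) * (L * numNear ι τ v w.2) ∂ρ := by
    calc _ = ∑ _v : Fin q → Fin m × Bool, L * (q * (1 - √2 / 8)) := by simp
      _ ≤ _ := Finset.sum_le_sum fun v _ => by
        have : ∀ w : (∀ i, A.Msg i) × EuclideanSpace ℝ (Fin d),
            (∏ i, f i v (w.1 i)) * (L * numNear ι τ v w.2) =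
            L * (F v w.1 * numNear ι τ v w.2) := fun w => by simp only [hFdef]; ring
        simp_rw [this]
        rw [integral_const_mul]
        exact mul_le_mul_of_nonneg_left (hlow v) hLpos.le
  have hright : ∑ i, ∑ v, ∫ z, (f i v z - 1) ^ 2 ∂(N i) ≤
      Fintype.card (Fin q → Fin m × Bool) * (n * (τ ^ 2 / m * (2 * ε) ^ 2)) := by
    refine (Finset.sum_le_sum fun i _ => hfχ i).trans_eq ?_
    simp only [Finset.sum_const, Finset.card_univ, Fintype.card_fin, nsmul_eq_mul]
    ring
  have hmain : L * (q * (1 - √2 / 8)) ≤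
      Real.log (2 ^ q) + n * (τ ^ 2 / m * (2 * ε) ^ 2) := by
    refine le_of_mul_le_mul_left ?_ hV
    rw [mul_add]
    linarith
  rw [Real.log_pow] at hmain
  -- The coefficient of `qL` is then at least `1 - 3/16 - 1/2 = 5/16`, above the claimed `1/4`.
  have hs2 : √2 ≤ 3 / 2 := by
    rw [Real.sqrt_le_left (by norm_num)]; norm_num
  nlinarith [mul_le_mul_of_nonneg_left hLlog hq'.le, mul_pos hq' hLpos,
    mul_le_mul_of_nonneg_left hs2 (mul_pos hq' hLpos).le]

/-- Small error on the whole class forces a large number of users. -/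
lemma dimension_le_of_expectedError_le {k : ℕ} (hk : 1 ≤ k) (hkd : k ≤ d)
    (A : NonInteractiveAlgorithm.{u} n d) {ε : ℝ} (hε : 0 < ε)
    (hε1 : ε ≤ 1) (hA : A.IsLDP (dataUniverse d 2) ε) {ν : ℝ} (hν : 0 < ν) (hνk : ν ≤ 1 / √(k : ℝ))
    (herr : ∀ θ P, InClass k d 2 θ P → A.expectedError P θ ≤ ENNReal.ofReal (ν / 8)) :
    (d : ℝ) * k * Real.log ((d : ℝ) / k) / 128 ≤ n * (ν ^ 2 * ε ^ 2) := by
  rcases hkd.eq_or_lt with rfl | hlt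
  · have : (k : ℝ) ≠ 0 := by positivity
    rw [div_self this]
    simp
    positivity
  -- Capping `q` at `d / 2` guarantees blocks of size at least `2`, also when `k` is close to `d`.
  set q := min k (d / 2) with hq
  set m := d / q with hm
  have hq0 : 0 < q := by omega
  have hqk : q ≤ k := min_le_left _ _
  have hm2 : 2 ≤ m := by
    rw [hm, Nat.le_div_iff_mul_le hq0]; omega
  have hqm : q * m ≤ d := Nat.mul_div_le d q
  have hdm : d < q * (m + 1) := by
    rw [mul_comm]; exact Nat.lt_mul_of_div_lt (Nat.lt_succ_self _) hq0
  have hι : Nonempty (Fin q × Fin m ↪ Fin d) :=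
    Function.Embedding.nonempty_of_card_le (by simpa using hqm)
  obtain ⟨ι⟩ := hι
  have hqR : (0 : ℝ) < q := by exact_mod_cast hq0
  have hkR : (0 : ℝ) < k := by exact_mod_cast hk
  have hmR : (2 : ℝ) ≤ m := by exact_mod_cast hm2
  have hdR : (0 : ℝ) < d := by exact_mod_cast hk.trans hkd
  have hsq : √(q : ℝ) * √q = q := Real.mul_self_sqrt hqR.le
  have hsqpos : 0 < √(q : ℝ) := Real.sqrt_pos.mpr hqR
  -- This makes `√q τ = ν`, and `ν ≤ 1/√k` with `q ≤ k` gives the `ℓ₁` constraint `qτ ≤ 1`.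
  set τ := ν / √q with hτ
  have hqτ : q * τ ≤ 1 := by
    have h1 : q * τ = √q * ν := by
      rw [hτ]; field_simp; rw [sq, hsq]
    have h2 : √(q : ℝ) ≤ √k := Real.sqrt_le_sqrt (by exact_mod_cast hqk)
    have h3 : √(k : ℝ) * ν ≤ 1 := by
      have : 0 < √(k : ℝ) := Real.sqrt_pos.mpr hkR
      rw [le_div_iff₀ this] at hνk
      linarith
    rw [h1]
    exact (mul_le_mul_of_nonneg_right h2 hν.le).trans h3
  have hτ0 : 0 < τ := by positivity
  have hmain := mul_log_le_of_expectedError_le A hε.le hε1 hA ι hq0 hm2 hτ0 hqτ fun v => by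
    have hν' : √q * τ / 8 = ν / 8 := by rw [hτ]; field_simp
    rw [hν']
    exact herr _ _ (inClass_recordLaw ((sum_abs_sparseVec_le ι τ hτ0.le v).trans hqτ)
      ((ncard_support_sparseVec_le ι τ v).trans hqk))
  have hτsq : τ ^ 2 = ν ^ 2 / q := by rw [hτ, div_pow, Real.sq_sqrt hqR.le]
  rw [hτsq] at hmain
  have hmain2 : (q * m : ℝ) * (q * Real.log (2 * m)) ≤ 16 * (n * (ν ^ 2 * ε ^ 2)) := by
    have h1 : (n : ℝ) * (ν ^ 2 / q / m * (2 * ε) ^ 2) =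
        4 * (n * (ν ^ 2 * ε ^ 2)) / (q * m) := by field_simp; ring
    rw [h1, le_div_iff₀ (by positivity)] at hmain
    linarith
  have hd2 : (d : ℝ) / 2 ≤ q * m := by
    have : (d : ℝ) < q * (m + 1) := by exact_mod_cast hdm
    nlinarith
  have hlog : k * Real.log ((d : ℝ) / k) / 2 ≤ q * Real.log (2 * m) := by
    have hlogm : 1 ≤ Real.log (2 * m) := by
      rw [Real.le_log_iff_exp_le (by positivity)]
      have := Real.exp_one_lt_d9
      linarith
    by_cases hkd2 : k ≤ d / 2
    · have hqk' : q = k := min_eq_left hkd2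
      have h1 : (d : ℝ) / k ≤ 2 * m := by
        rw [div_le_iff₀ hkR, ← hqk']; linarith
      have h2 : Real.log ((d : ℝ) / k) ≤ Real.log (2 * m) :=
        Real.log_le_log (by positivity) h1
      rw [hqk']
      nlinarith [mul_le_mul_of_nonneg_left h2 hkR.le]
    -- For `k > d/2` the target is itself small: `k log(d/k) ≤ d - k ≤ 2q`, while `log(2m) ≥ log 4 ≥
    -- 1`.
    · have h1 : k * Real.log ((d : ℝ) / k) ≤ d - k := by
        have := Real.log_le_sub_one_of_pos (div_pos hdR hkR)
        calc k * Real.log ((d : ℝ) / k) ≤ k * (d / k - 1) := by gcongr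
          _ = d - k := by field_simp
      have h2 : d - k ≤ 2 * q := by omega
      have h3 : (d : ℝ) - k ≤ 2 * q := by
        rw [← Nat.cast_sub hkd]; exact_mod_cast h2
      nlinarith
  have h0 : 0 ≤ k * Real.log ((d : ℝ) / k) :=
    mul_nonneg hkR.le (Real.log_nonneg (by rw [le_div_iff₀ hkR]; exact_mod_cast by omega))
  have hprod := mul_le_mul hd2 hlog (by linarith) (by positivity)
  nlinarith

end Error

end SparseLDP
end

theorem mainTheorem1 :
    ∃ c : ℝ, 0 < c ∧ ∀ (n d k : ℕ), 1 ≤ k → k ≤ d → ∀ ε : ℝ, 0 < ε → ε ≤ 1 →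
      ∀ A : SparseLDP.NonInteractiveAlgorithm.{u} n d, A.IsLDP (SparseLDP.dataUniverse d 2) ε →
        (∀ ν : ℝ, 0 < ν → ν ≤ 1 / √(k : ℝ) →
          (∀ θ P, SparseLDP.InClass k d 2 θ P → A.expectedError P θ ≤ ENNReal.ofReal (ν / 8)) →
          c * ((d : ℝ) * k * Real.log ((d : ℝ) / k) / (ν ^ 2 * ε ^ 2)) ≤ n) ∧
        (1 ≤ n → ∃ θ P, SparseLDP.InClass k d 2 θ P ∧
          ENNReal.ofReal (c * min (1 / √(k : ℝ))
            √((d : ℝ) * k * Real.log ((d : ℝ) / k) / (n * ε ^ 2))) ≤ A.expectedError P θ) := by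
  refine ⟨1 / 128, by norm_num, fun n d k hk hkd ε hε hε1 A hA => ⟨?_, ?_⟩⟩
  · intro ν hν hνk herr
    have h := SparseLDP.dimension_le_of_expectedError_le hk hkd A hε hε1 hA hν hνk herr
    have hpos : 0 < ν ^ 2 * ε ^ 2 := by positivity
    rw [← mul_div_assoc, div_le_iff₀ hpos]
    linarith
  · intro hn
    have hnR : (0 : ℝ) < n := by exact_mod_cast hn
    have hkR : (0 : ℝ) < k := by exact_mod_cast hk
    set X := (d : ℝ) * k * Real.log ((d : ℝ) / k) with hX
    -- If `X ≤ 0` the claimed error bound is zero and any instance serves.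
    rcases le_or_gt X 0 with hX0 | hX0
    · refine ⟨0, SparseLDP.recordLaw 0,
        SparseLDP.inClass_recordLaw SparseLDP.sum_abs_zero_le (by simp), ?_⟩
      rw [Real.sqrt_eq_zero_of_nonpos (div_nonpos_of_nonpos_of_nonneg hX0 (by positivity)),
        min_eq_right (by positivity)]
      simp
    · set b := min (1 / √(k : ℝ)) √(X / (n * ε ^ 2)) with hb
      have hb0 : 0 < b := lt_min (by positivity) (Real.sqrt_pos.mpr (by positivity))
      by_contra! hcon
      -- With `ν = b/16` the assumed error `b/128` equals `ν/8`. Then `X/128 ≤ n b²ε²/256 ≤ X/256`,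
      -- impossible for `X > 0`.
      have h := SparseLDP.dimension_le_of_expectedError_le hk hkd A hε hε1 hA (ν := b / 16)
        (by positivity) (by linarith [min_le_left (1 / √(k : ℝ)) √(X / (n * ε ^ 2))])
        fun θ P hP => by
          refine (hcon θ P hP).le.trans_eq ?_
          congr 1; ring
      have hbsq : b ^ 2 ≤ X / (n * ε ^ 2) := by
        rw [← Real.sq_sqrt (show 0 ≤ X / (n * ε ^ 2) by positivity)]
        exact pow_le_pow_left₀ hb0.le (min_le_right _ _) 2
      rw [le_div_iff₀ (by positivity)] at hbsq
      rw [← hX] at h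
      nlinarith
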